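/- **Setting.** Let $S$ be a commutative unitary ring, $Q$ a group that acts on $S$ by ring automorphisms, $\kappa_Q\colon Q\to\mathrm{Aut}(S)$ the action, and $R=S^Q$ the subring of fixed elements. Let $A$ be a central $S$-algebra, i.e. a ring whose center is $S$. Write $\mathrm U(-)$ for groups of units, $\mathrm{Aut}(A)$ for the group of ring automorphisms of $A$, $\partial\colon \mathrm U(A)\to\mathrm{Aut}(A)$ for the map that sends a unit to its inner automorphism, and $\mathrm{Out}(A)=\mathrm{coker}\,\partial$. A *$Q$-normal structure* on $A$ is a homomorphism $\sigma\colon Q\to\mathrm{Out}(A)$ whose composite with the restriction map $\mathrm{Out}(A)\to\mathrm{Aut}(S)$ is $\kappa_Q$. The *Teichmüller class* of the $Q$-normal algebra $(A,\sigma)$ is the class in $\mathrm H^3(Q,\mathrm U(S))$ represented by the crossed 2-fold extension $$0\to \mathrm U(S)\to \mathrm U(A)\to \mathrm{Aut}(A)\times_{\mathrm{Out}(A)}Q\to Q\to 1 .$$ Let $C$ be an $R$-algebra that contains $A$ as an $R$-subalgebra, and let $N^{\mathrm U(C)}(A)=\{u\in\mathrm U(C): uAu^{-1}=A\}$. Conjugation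 in $C$ induces $\eta_\sharp\colon N^{\mathrm U(C)}(A)/\mathrm U(A)\to\mathrm{Out}(A)$. A *strong Deuring embedding* of $A$ into $C$ (relative to $\kappa_Q$) is such an embedding $A\subseteq C$ together with a homomorphism $\chi\colon Q\to N^{\mathrm U(C)}(A)/\mathrm U(A)$ such that the composite of $\eta_\sharp\circ\chi$ with $\mathrm{Out}(A)\to\mathrm{Aut}(S)$ is $\kappa_Q$; it *induces* the $Q$-normal structure $\eta_\sharp\circ\chi$ on $A$. Given a $Q$-normal structure $\sigma$ on $A$, consider a group extension $\mathrm e\colon 1\to \mathrm U(A)\xrightarrow{j}\Gamma\xrightarrow{\pi} Q\to 1$ together with a morphism of crossed modules $(1,\vartheta)\colon(\mathrm U(A),\Gamma,j)\to(\mathrm U(A),\mathrm{Aut}(A),\partial)$ that induces $\sigma$. The *crossed product algebra* $(A,Q,\mathrm e,\vartheta)$ is the quotient of the twisted group ring $A^t\Gamma$ (relative to $\vartheta$) by the two-sided ideal generated by the elements $y-j(y)$, $y\in\mathrm U(A)$; it is an $R$-algebra through $R\subseteq S\subseteq A$. **Theorem.** Let $A$ be a central $S$-algebra. 1. For every $Q$-normal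 structure $\sigma$ on $A$, the Teichmüller class of $(A,\sigma)$ is zero if and only if $A$ admits a strong Deuring embedding $(C,\chi)$ into an algebra $C$ over $R$ that induces $\sigma$. 2. Consequently $A$ admits a strong Deuring embedding into some algebra $C$ over $R$ if and only if $A$ admits a $Q$-normal structure with zero Teichmüller class. 3. The embedding is realised by a crossed product: if the Teichmüller class of $(A,\sigma)$ is zero, there are an extension $\mathrm e$ and a morphism $(1,\vartheta)$ as above that induce $\sigma$; and for all such $\mathrm e$, $\vartheta$, with $C=(A,Q,\mathrm e,\vartheta)$, the canonical map $A\to C$ is injective, the canonical map $\Gamma\to\mathrm U(C)$ takes values in $N^{\mathrm U(C)}(A)$, and $A\to C$ together with the homomorphism $\chi\colon Q\to N^{\mathrm U(C)}(A)/\mathrm U(A)$ induced by $\Gamma\to N^{\mathrm U(C)}(A)$ is a strong Deuring embedding of $A$ into $C$ that induces $\sigma$. -/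

import Mathlib

universe u v w x

noncomputable section

namespace Teichmuller

/-! ### Crossed modules and crossed 2-fold extensions -/

/-- A crossed module `(C, Γ, ∂)`: an action of `Γ` on `C` and a homomorphism `∂ : C → Γ`, which is
equivariant for conjugation on `Γ`, such that `b c b⁻¹ = ^{∂ b} c`. -/
structure CrossedModule (C Γ : Type*) [Group C] [Group Γ] where
  act : Γ →* MulAut C
  bd : C →* Γ
  bd_act : ∀ γ c, bd (act γ c) = γ * bd c * γ⁻¹
  peiffer : ∀ b c, act (bd b) c = b * c * b⁻¹

/-- A morphism `(φ, ψ)` of crossed modules. -/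
structure CrossedModule.Hom {C Γ C' Γ' : Type*} [Group C] [Group Γ] [Group C'] [Group Γ']
    (X : CrossedModule C Γ) (X' : CrossedModule C' Γ') where
  φ : C →* C'
  ψ : Γ →* Γ'
  bd_φ : ∀ c, X'.bd (φ c) = ψ (X.bd c)
  equivariant : ∀ γ c, φ (X.act γ c) = X'.act (ψ γ) (φ c)

/-- A crossed 2-fold extension `0 → M → C → Γ → G → 1` which induces on the abelian group `M` the
`G`-module structure `ρ`. -/
structure CrossedTwoFoldExtension {M G : Type*} [CommGroup M] [Group G] (ρ : G →* MulAut M)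
    (C Γ : Type*) [Group C] [Group Γ] extends CrossedModule C Γ where
  ι : M →* C
  π : Γ →* G
  ι_injective : Function.Injective ι
  range_ι : ι.range = bd.ker
  range_bd : bd.range = π.ker
  π_surjective : Function.Surjective π
  act_ι : ∀ γ m, act γ (ι m) = ι (ρ (π γ) m)

/-! ### The class in the third cohomology group of a crossed 2-fold extension -/

/-- A `G`-module `M`, written multiplicatively, as an object of `Rep`. The coefficient ring is
`ℤ`, lifted to the universe of `G` because `groupCohomology` wants them in the same universe. -/
def moduleRep {M G : Type u} [CommGroup M] [Group G] (ρ : G →* MulAut M) :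
    Rep.{u} (ULift.{u} ℤ) G :=
  Rep.of (X := Additive M)
    { toFun := fun g =>
        { toFun := fun m => Additive.ofMul (ρ g m.toMul)
          map_add' := fun a b => by simp
          map_smul' := fun n a => by
            obtain ⟨n⟩ := n
            change Additive.ofMul (ρ g ((n • a).toMul)) = n • Additive.ofMul (ρ g a.toMul)
            simp }
      map_one' := by
        ext m
        simp
      map_mul' := fun g h => by
        ext m
        simp }

/-- The data that enter the cocycle of a crossed 2-fold extension: a set-theoretic section `s` of
`Γ → G`, elements `f p q` of `C` which measure the deviation of `s` from a homomorphism, and the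
resulting 3-cochain `k` with values in `M`. -/
structure CrossedTwoFoldExtension.CocycleData {M G : Type*} [CommGroup M] [Group G]
    {ρ : G →* MulAut M} {C Γ : Type*} [Group C] [Group Γ]
    (e : CrossedTwoFoldExtension ρ C Γ) where
  s : G → Γ
  π_s : ∀ q, e.π (s q) = q
  f : G → G → C
  bd_f : ∀ p q, e.bd (f p q) * s (p * q) = s p * s q
  k : G → G → G → M
  ι_k : ∀ p q r, e.ι (k p q r) * (f p q * f (p * q) r) = e.act (s p) (f q r) * f p (q * r)

namespace CrossedTwoFoldExtension

variable {M G : Type*} [CommGroup M] [Group G] {ρ : G →* MulAut M} {C Γ : Type*}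
  [Group C] [Group Γ] (e : CrossedTwoFoldExtension ρ C Γ)

theorem bd_ι (m : M) : e.bd (e.ι m) = 1 := by
  have : e.ι m ∈ e.bd.ker := e.range_ι ▸ ⟨m, rfl⟩
  exact this

theorem ι_comm (m : M) (c : C) : e.ι m * c = c * e.ι m := by
  have h := e.peiffer (e.ι m) c
  rw [e.bd_ι, map_one, MulAut.one_apply] at h
  exact (eq_mul_inv_iff_mul_eq.mp h).symm

theorem nonempty_cocycleData : Nonempty e.CocycleData := by
  choose s hs using e.π_surjective
  have hf : ∀ p q, ∃ c, e.bd c = s p * s q * (s (p * q))⁻¹ := fun p q => by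
    have : s p * s q * (s (p * q))⁻¹ ∈ e.bd.range := by
      rw [e.range_bd, MonoidHom.mem_ker]
      simp [hs]
    exact this
  choose f hf using hf
  have hk : ∀ p q r, ∃ m, e.ι m =
      e.act (s p) (f q r) * f p (q * r) * (f p q * f (p * q) r)⁻¹ := fun p q r => by
    have : e.act (s p) (f q r) * f p (q * r) * (f p q * f (p * q) r)⁻¹ ∈ e.ι.range := by
      rw [e.range_ι, MonoidHom.mem_ker]
      simp only [map_mul, map_inv, e.bd_act, hf, mul_assoc p q r]
      group
    exact this
  choose k hk using hk
  exact ⟨⟨s, hs, f, fun p q => by rw [hf]; group, k, fun p q r => by rw [hk]; group⟩⟩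

variable {e}

theorem CocycleData.cocycle (d : e.CocycleData) (p q r t : G) :
    ρ p (d.k q r t) * d.k p (q * r) t * d.k p q r = d.k p q (r * t) * d.k (p * q) r t := by
  apply e.ι_injective
  have h1 := d.ι_k q r t
  have h2 := d.ι_k p (q * r) t
  have h3 := d.ι_k p q r
  have h4 := d.ι_k p q (r * t)
  have h5 := d.ι_k (p * q) r t
  have h6 := congrArg (e.act (d.s p)) h1
  simp only [map_mul, e.act_ι, d.π_s] at h6
  have h7 : e.act (d.s p) (e.act (d.s q) (d.f r t)) * d.f p q =
      d.f p q * e.act (d.s (p * q)) (d.f r t) := by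
    rw [← MulAut.mul_apply, ← map_mul, ← d.bd_f, map_mul, MulAut.mul_apply, e.peiffer]
    group
  set c := d.f p q * d.f (p * q) r * d.f (p * q * r) t with hc
  have key1 : e.act (d.s p) (e.act (d.s q) (d.f r t)) * e.act (d.s p) (d.f q (r * t)) *
      d.f p (q * (r * t)) = e.ι (ρ p (d.k q r t) * d.k p (q * r) t * d.k p q r) * c := by
    rw [← h6]
    simp only [mul_assoc] at *
    rw [← h2, ← mul_assoc (e.act (d.s p) (d.f q r)), ← e.ι_comm, mul_assoc,
      ← mul_assoc (e.act (d.s p) (d.f q r)), ← h3]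
    simp only [map_mul, hc, mul_assoc]
  have key2 : e.act (d.s p) (e.act (d.s q) (d.f r t)) * e.act (d.s p) (d.f q (r * t)) *
      d.f p (q * (r * t)) = e.ι (d.k p q (r * t) * d.k (p * q) r t) * c := by
    rw [mul_assoc, ← h4, ← mul_assoc, ← e.ι_comm, mul_assoc, ← mul_assoc _ (d.f p q), h7,
      mul_assoc (d.f p q)]
    simp only [mul_assoc] at *
    rw [← h5, ← mul_assoc (d.f p q), ← e.ι_comm]
    simp only [map_mul, hc, mul_assoc]
  exact mul_right_cancel (key1.symm.trans key2)

end CrossedTwoFoldExtension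

namespace CrossedTwoFoldExtension

variable {M G : Type u} [CommGroup M] [Group G] {ρ : G →* MulAut M} {C Γ : Type*}
  [Group C] [Group Γ]

/-- The 3-cochain of a choice of cocycle data. -/
def CocycleData.cochain {e : CrossedTwoFoldExtension ρ C Γ} (d : e.CocycleData) :
    (Fin 3 → G) → moduleRep ρ :=
  fun g => (Additive.ofMul (d.k (g 0) (g 1) (g 2)) : Additive M)

theorem CocycleData.d_cochain {e : CrossedTwoFoldExtension ρ C Γ} (d : e.CocycleData) :
    inhomogeneousCochains.d (moduleRep ρ) 3 d.cochain = 0 := by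
  funext g
  have h := congrArg Additive.ofMul (d.cocycle (g 0) (g 1) (g 2) (g 3))
  simp only [ofMul_mul] at h
  change (Additive.ofMul (ρ (g 0) (d.k (g 1) (g 2) (g 3))) : Additive M) +
    Finset.univ.sum (fun j : Fin 4 => ((-1 : ULift.{u} ℤ) ^ ((j : ℕ) + 1)) •
      (Additive.ofMul (d.k (Fin.contractNth j (· * ·) g 0) (Fin.contractNth j (· * ·) g 1)
        (Fin.contractNth j (· * ·) g 2)) : Additive M)) = 0
  have e1 : ∀ a : Additive M, (-1 : ULift.{u} ℤ) • a = -a := fun a => by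
    rw [neg_smul, one_smul]
  rw [Fin.sum_univ_four]
  change (Additive.ofMul (ρ (g 0) (d.k (g 1) (g 2) (g 3))) : Additive M) +
    (((-1 : ULift.{u} ℤ) ^ 1) • Additive.ofMul (d.k (g 0 * g 1) (g 2) (g 3)) +
      ((-1 : ULift.{u} ℤ) ^ 2) • Additive.ofMul (d.k (g 0) (g 1 * g 2) (g 3)) +
      ((-1 : ULift.{u} ℤ) ^ 3) • Additive.ofMul (d.k (g 0) (g 1) (g 2 * g 3)) +
      ((-1 : ULift.{u} ℤ) ^ 4) • Additive.ofMul (d.k (g 0) (g 1) (g 2))) = 0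
  rw [show (-1 : ULift.{u} ℤ) ^ 1 = -1 by ring, show (-1 : ULift.{u} ℤ) ^ 2 = 1 by ring,
    show (-1 : ULift.{u} ℤ) ^ 3 = -1 by ring, show (-1 : ULift.{u} ℤ) ^ 4 = 1 by ring,
    one_smul, one_smul, e1, e1]
  rw [← sub_eq_zero] at h
  rw [← h]
  abel

/-- The class in `H³(G, M)` represented by a crossed 2-fold extension: the class of the 3-cocycle of
some cocycle data (another choice changes the cocycle by a coboundary). -/
def cohomologyClass (e : CrossedTwoFoldExtension ρ C Γ) : groupCohomology (moduleRep ρ) 3 :=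
  let d : e.CocycleData := Classical.choice e.nonempty_cocycleData
  groupCohomology.π (moduleRep ρ) 3 (groupCohomology.cocyclesMk d.cochain d.d_cochain)

end CrossedTwoFoldExtension

/-! ### Automorphisms and outer automorphisms of a ring -/

section Ring

variable (A : Type*) [Ring A]

/-- The action of `Aut(A)` on the group of units `U(A)`. -/
def unitsAut : RingAut A →* MulAut Aˣ where
  toFun α := Units.mapEquiv (α : A ≃* A)
  map_one' := by ext; rfl
  map_mul' _ _ := by ext; rfl

@[simp] theorem coe_unitsAut (α : RingAut A) (u : Aˣ) :
    ((unitsAut A α u : Aˣ) : A) = α (u : A) := rfl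

/-- The homomorphism `∂ : U(A) → Aut(A)` that sends a unit to its inner automorphism. -/
def innerAut : Aˣ →* RingAut A where
  toFun u :=
    { toFun := fun a => u * a * (u⁻¹ : Aˣ)
      invFun := fun a => (u⁻¹ : Aˣ) * a * u
      left_inv := fun a => by simp [mul_assoc]
      right_inv := fun a => by simp [mul_assoc]
      map_mul' := fun a b => by simp [mul_assoc]
      map_add' := fun a b => by simp [mul_add, add_mul] }
  map_one' := by ext; simp
  map_mul' u v := by ext; simp [mul_assoc]

@[simp] theorem innerAut_apply (u : Aˣ) (a : A) : innerAut A u a = u * a * (u⁻¹ : Aˣ) := rfl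

/-- The crossed module `(U(A), Aut(A), ∂)`. -/
def autCrossedModule : CrossedModule Aˣ (RingAut A) where
  act := unitsAut A
  bd := innerAut A
  bd_act α u := by
    ext a
    change (α u : A) * a * ((unitsAut A α u)⁻¹ : Aˣ) = α (u * α⁻¹ a * (u⁻¹ : Aˣ))
    rw [← map_inv, coe_unitsAut, map_mul, map_mul]
    congr 2
    exact (α.apply_symm_apply a).symm
  peiffer u v := by
    ext
    simp

instance : (innerAut A).range.Normal where
  conj_mem := by
    rintro _ ⟨u, rfl⟩ α
    exact ⟨unitsAut A α u, (autCrossedModule A).bd_act α u⟩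

/-- The group `Out(A)` of outer automorphisms, the cokernel of `∂`. -/
abbrev Out : Type _ := RingAut A ⧸ (innerAut A).range

end Ring

/-! ### Central algebras and normal structures -/

section Central

variable (S : Type*) (A : Type*) [CommRing S] [Ring A] [Algebra S A] [Algebra.IsCentral S A]
  [FaithfulSMul S A]

/-- The ground ring of a central algebra, identified with the center. -/
def centerEquiv : S ≃+* Subring.center A :=
  RingEquiv.ofBijective
    ((algebraMap S A).codRestrict (Subring.center A) fun s =>
      Subring.mem_center_iff.mpr fun a => (Algebra.commutes s a).symm)
    ⟨fun s t h => FaithfulSMul.algebraMap_injective S A (congrArg Subtype.val h), fun z => by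
      have hz : (z : A) ∈ Subalgebra.center S A :=
        Subalgebra.mem_center_iff.mpr (Subring.mem_center_iff.mp z.2)
      obtain ⟨s, hs⟩ := Algebra.mem_bot.mp (Algebra.IsCentral.out hz)
      exact ⟨s, Subtype.ext hs⟩⟩

@[simp] theorem coe_centerEquiv (s : S) : ((centerEquiv S A s : Subring.center A) : A) =
    algebraMap S A s := rfl

theorem algebraMap_centerEquiv_symm (z : Subring.center A) :
    algebraMap S A ((centerEquiv S A).symm z) = z := by
  rw [← coe_centerEquiv, RingEquiv.apply_symm_apply]

/-- Restriction of automorphisms of a central algebra to the ground ring. -/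
def res : RingAut A →* RingAut S where
  toFun α := ((centerEquiv S A).trans (Subring.centerCongr α)).trans (centerEquiv S A).symm
  map_one' := by
    ext s
    exact (centerEquiv S A).symm_apply_apply s
  map_mul' α β := by
    ext s
    apply FaithfulSMul.algebraMap_injective S A
    simp [algebraMap_centerEquiv_symm]
    rfl

theorem algebraMap_res (α : RingAut A) (s : S) :
    algebraMap S A (res S A α s) = α (algebraMap S A s) :=
  algebraMap_centerEquiv_symm S A _

/-- The map `Out(A) → Aut(S)` induced by restriction. -/
def resOut : Out A →* RingAut S :=
  QuotientGroup.lift _ (res S A) <| by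
    rintro _ ⟨u, rfl⟩
    ext s
    apply FaithfulSMul.algebraMap_injective S A
    rw [algebraMap_res, innerAut_apply, ← Algebra.commutes]
    simp [mul_assoc]

end Central

section Normal

variable (S Q : Type*) (A : Type*) [CommRing S] [Group Q] [MulSemiringAction Q S] [Ring A]
  [Algebra S A] [Algebra.IsCentral S A] [FaithfulSMul S A]

/-- A `Q`-normal structure on a central `S`-algebra `A`: a homomorphism `Q → Out(A)` that lifts the
action `Q → Aut(S)`. -/
structure QNormalStructure where
  toHom : Q →* Out A
  lifts : (resOut S A).comp toHom = MulSemiringAction.toRingAut Q S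

/-- The `Q`-module structure on the group of units `U(S)`. -/
def unitsAction : Q →* MulAut Sˣ := (unitsAut S).comp (MulSemiringAction.toRingAut Q S)

variable {S Q A}

namespace QNormalStructure

variable (σ : QNormalStructure S Q A)

variable {σ} in
theorem algebraMap_smul {α : RingAut A} {q : Q} (h : (QuotientGroup.mk α : Out A) = σ.toHom q)
    (s : S) : α (algebraMap S A s) = algebraMap S A (q • s) := by
  have h1 := DFunLike.congr_fun (DFunLike.congr_fun σ.lifts q) s
  rw [MonoidHom.comp_apply, ← h] at h1
  rw [← algebraMap_res]
  exact congrArg (algebraMap S A) h1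

/-- The fiber product group `B^σ` of `Aut(A)` and `Q` over `Out(A)`. -/
def fiberProduct : Subgroup (RingAut A × Q) :=
  ((QuotientGroup.mk' (innerAut A).range).comp (MonoidHom.fst _ _)).eqLocus
    (σ.toHom.comp (MonoidHom.snd _ _))

/-- The Teichmüller complex `0 → U(S) → U(A) → B^σ → Q → 1`. -/
def teichmullerComplex : CrossedTwoFoldExtension (unitsAction S Q) Aˣ σ.fiberProduct where
  act := (unitsAut A).comp ((MonoidHom.fst _ _).comp σ.fiberProduct.subtype)
  bd := ((innerAut A).prod 1).codRestrict σ.fiberProduct fun u => by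
    change (QuotientGroup.mk (innerAut A u) : Out A) = σ.toHom 1
    rw [map_one, QuotientGroup.eq_one_iff]
    exact ⟨u, rfl⟩
  bd_act γ u := by
    apply Subtype.ext
    refine Prod.ext ((autCrossedModule A).bd_act γ.1.1 u) ?_
    change (1 : Q) = γ.1.2 * 1 * γ.1.2⁻¹
    simp
  peiffer u v := (autCrossedModule A).peiffer u v
  ι := Units.map (algebraMap S A)
  π := (MonoidHom.snd _ _).comp σ.fiberProduct.subtype
  ι_injective := Units.map_injective (FaithfulSMul.algebraMap_injective S A)
  range_ι := by
    ext u
    constructor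
    · rintro ⟨s, rfl⟩
      apply Subtype.ext
      refine Prod.ext ?_ rfl
      ext a
      change algebraMap S A s * a * _ = a
      rw [Algebra.commutes, mul_assoc]
      change a * ((Units.map (algebraMap S A : S →* A) s : Aˣ) * _) = a
      rw [Units.mul_inv, mul_one]
    · intro hu
      have h1 : innerAut A u = 1 := congrArg (fun z => z.1.1) (show _ = _ from hu)
      have hc : ∀ a, (u : A) * a = a * u := fun a => by
        have := DFunLike.congr_fun h1 a
        rw [innerAut_apply, RingAut.one_apply] at this
        calc (u : A) * a = (u * a * (u⁻¹ : Aˣ)) * u := by simp [mul_assoc]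
          _ = a * u := by rw [this]
      have hc' : ∀ a, ((u⁻¹ : Aˣ) : A) * a = a * (u⁻¹ : Aˣ) := fun a => by
        rw [Units.inv_mul_eq_iff_eq_mul, ← mul_assoc, hc, mul_assoc, Units.mul_inv, mul_one]
      let z : Subring.center A := ⟨u, Subring.mem_center_iff.mpr fun a => (hc a).symm⟩
      let z' : Subring.center A :=
        ⟨(u⁻¹ : Aˣ), Subring.mem_center_iff.mpr fun a => (hc' a).symm⟩
      have e1 : z * z' = 1 := Subtype.ext u.mul_inv
      have e2 : z' * z = 1 := Subtype.ext u.inv_mul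
      refine ⟨⟨(centerEquiv S A).symm z, (centerEquiv S A).symm z', ?_, ?_⟩, ?_⟩
      · rw [← map_mul, e1, map_one]
      · rw [← map_mul, e2, map_one]
      · ext
        exact algebraMap_centerEquiv_symm S A z
  range_bd := by
    ext γ
    constructor
    · rintro ⟨u, rfl⟩
      rfl
    · intro hγ
      have h2 : γ.1.2 = 1 := hγ
      have h3 : (QuotientGroup.mk γ.1.1 : Out A) = σ.toHom γ.1.2 := γ.2
      rw [h2, map_one, QuotientGroup.eq_one_iff] at h3
      obtain ⟨u, hu⟩ := h3
      exact ⟨u, Subtype.ext (Prod.ext hu h2.symm)⟩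
  π_surjective q := by
    obtain ⟨α, hα⟩ := QuotientGroup.mk_surjective (σ.toHom q)
    exact ⟨⟨(α, q), hα⟩, rfl⟩
  act_ι γ s := by
    ext
    change γ.1.1 (algebraMap S A s) = algebraMap S A (γ.1.2 • (s : S))
    have h3 : (QuotientGroup.mk γ.1.1 : Out A) = σ.toHom γ.1.2 := γ.2
    exact algebraMap_smul h3 s

end QNormalStructure

end Normal

/-- The Teichmüller class in `H³(Q, U(S))` of a `Q`-normal algebra. -/
def QNormalStructure.teichmullerClass {S Q : Type u} {A : Type v} [CommRing S] [Group Q]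
    [MulSemiringAction Q S] [Ring A] [Algebra S A] [Algebra.IsCentral S A] [FaithfulSMul S A]
    (σ : QNormalStructure S Q A) : groupCohomology (moduleRep (unitsAction S Q)) 3 :=
  σ.teichmullerComplex.cohomologyClass

/-! ### Strong Deuring embeddings -/

section Normalizer

variable {A C : Type*} [Ring A] [Ring C] (i : A →+* C)

/-- The unitNormalizer `N^{U(C)}(A)` of (the image of) `A` in the group of units of `C`. -/
def unitNormalizer : Subgroup Cˣ where
  carrier := {u | ∀ c : C, c ∈ i.range ↔ (u : C) * c * (u⁻¹ : Cˣ) ∈ i.range}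
  one_mem' c := by simp
  mul_mem' {u v} hu hv c := by
    rw [hv c, hu]
    simp [mul_assoc]
  inv_mem' {u} hu c := by
    rw [hu (((u⁻¹ : Cˣ) : C) * c * (u⁻¹⁻¹ : Cˣ))]
    simp [mul_assoc]

/-- The inclusion of `U(A)` into the unitNormalizer. -/
def unitsIncl : Aˣ →* unitNormalizer i :=
  (Units.map (i : A →* C)).codRestrict (unitNormalizer i) fun u c => by
    constructor
    · rintro ⟨a, rfl⟩
      exact ⟨u * a * (u⁻¹ : Aˣ), by simp [← map_inv]⟩
    · rintro ⟨a, ha⟩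
      refine ⟨(u⁻¹ : Aˣ) * a * u, ?_⟩
      rw [map_mul, map_mul, ha]
      simp only [← map_inv, Units.coe_map, MonoidHom.coe_coe, mul_assoc]
      rw [← map_mul i, Units.inv_mul, map_one, mul_one, ← mul_assoc, ← map_mul i, Units.inv_mul,
        map_one, one_mul]

@[simp] theorem coe_unitsIncl (u : Aˣ) : (((unitsIncl i u : unitNormalizer i) : Cˣ) : C) = i u := rfl

variable {i} (hi : Function.Injective i)

/-- The element `u a u⁻¹` of `A`, for `u` in the unitNormalizer. -/
def conjFun (u : unitNormalizer i) (a : A) : A := ((u.2 (i a)).mp ⟨a, rfl⟩).choose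

theorem map_conjFun (u : unitNormalizer i) (a : A) :
    i (conjFun u a) = ((u : Cˣ) : C) * i a * ((u : Cˣ)⁻¹ : Cˣ) :=
  ((u.2 (i a)).mp ⟨a, rfl⟩).choose_spec

/-- Conjugation by an element of the unitNormalizer, as an automorphism of `A`. -/
def conjAut (u : unitNormalizer i) : RingAut A where
  toFun := conjFun u
  invFun := conjFun u⁻¹
  left_inv a := hi <| by simp [map_conjFun, mul_assoc]
  right_inv a := hi <| by simp [map_conjFun, mul_assoc]
  map_mul' a b := hi <| by simp [map_conjFun, mul_assoc]
  map_add' a b := hi <| by simp [map_conjFun, mul_add, add_mul]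

theorem map_conjAut (u : unitNormalizer i) (a : A) :
    i (conjAut hi u a) = ((u : Cˣ) : C) * i a * ((u : Cˣ)⁻¹ : Cˣ) :=
  map_conjFun u a

/-- Conjugation by elements of the unitNormalizer, as a homomorphism `η : N^{U(C)}(A) → Aut(A)`,
`η u a = u a u⁻¹`. -/
def conjHom : unitNormalizer i →* RingAut A where
  toFun := conjAut hi
  map_one' := by
    ext a
    apply hi
    simp [map_conjAut]
  map_mul' u v := by
    ext a
    apply hi
    simp [map_conjAut, mul_assoc]

theorem conjHom_unitsIncl (u : Aˣ) : conjHom hi (unitsIncl i u) = innerAut A u := by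
  ext a
  apply hi
  rw [innerAut_apply, map_mul, map_mul]
  exact map_conjAut hi _ a

theorem normal_unitsIncl_range (hi : Function.Injective i) : (unitsIncl i).range.Normal where
  conj_mem := by
    rintro _ ⟨u, rfl⟩ n
    refine ⟨unitsAut A (conjHom hi n) u, ?_⟩
    ext
    exact map_conjAut hi n u

/-- The quotient group `N^{U(C)}(A)/U(A)`. -/
def NormalizerQuotient (_hi : Function.Injective i) : Type _ :=
  unitNormalizer i ⧸ (unitsIncl i).range

instance : Group (NormalizerQuotient hi) :=
  letI := normal_unitsIncl_range hi
  inferInstanceAs (Group (unitNormalizer i ⧸ (unitsIncl i).range))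

/-- The projection `N^{U(C)}(A) → N^{U(C)}(A)/U(A)`. -/
def normalizerMk : unitNormalizer i →* NormalizerQuotient hi :=
  letI := normal_unitsIncl_range hi
  QuotientGroup.mk' (unitsIncl i).range

/-- The homomorphism `η_♯ : N^{U(C)}(A)/U(A) → Out(A)` induced by `η`. -/
def conjOut : NormalizerQuotient hi →* Out A :=
  letI := normal_unitsIncl_range hi
  QuotientGroup.map (unitsIncl i).range (innerAut A).range (conjHom hi) <| by
    rintro _ ⟨u, rfl⟩
    exact ⟨u, (conjHom_unitsIncl hi u).symm⟩

end Normalizer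

section Deuring

variable (S Q : Type*) (A : Type*) [CommRing S] [Group Q] [MulSemiringAction Q S] [Ring A]
  [Algebra S A] [Algebra.IsCentral S A] [FaithfulSMul S A]

/-- A strong Deuring embedding of the central `S`-algebra `A` into the algebra `C` over the fixed
ring `R = S^Q`: an embedding of `R`-algebras together with a homomorphism
`χ : Q → N^{U(C)}(A)/U(A)` whose composite with `N^{U(C)}(A)/U(A) → Out(A) → Aut(S)` is the action
of `Q` on `S`. -/
structure StrongDeuringEmbedding (C : Type*) [Ring C] [Algebra (FixedPoints.subring S Q) C] where
  emb : A →ₐ[FixedPoints.subring S Q] C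
  injective : Function.Injective (emb : A →+* C)
  χ : Q →* NormalizerQuotient injective
  lifts : ((resOut S A).comp (conjOut injective)).comp χ = MulSemiringAction.toRingAut Q S

variable {S Q A}

/-- The `Q`-normal structure that arises from a strong Deuring embedding. -/
def StrongDeuringEmbedding.normalStructure {C : Type*} [Ring C]
    [Algebra (FixedPoints.subring S Q) C] (D : StrongDeuringEmbedding S Q A C) :
    QNormalStructure S Q A where
  toHom := (conjOut D.injective).comp D.χ
  lifts := D.lifts

end Deuring

/-! ### Crossed product algebras -/

/-- The twisted group ring `A^t Γ` for an action `θ` of `Γ` on `A`: the free left `A`-module on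
`Γ`, with `(a x) (b y) = (a ^x b) (x y)`. -/
def TwistedGroupRing {A Γ : Type*} [Ring A] [Group Γ] (_θ : Γ →* RingAut A) : Type _ :=
  SkewMonoidAlgebra A Γ

namespace TwistedGroupRing

variable {A Γ : Type*} [Ring A] [Group Γ] (θ : Γ →* RingAut A)

instance : Ring (TwistedGroupRing θ) :=
  letI : MulSemiringAction Γ A := MulSemiringAction.compHom A θ
  inferInstanceAs (Ring (SkewMonoidAlgebra A Γ))

/-- The element `a x` of the twisted group ring. -/
def mk (a : A) (x : Γ) : TwistedGroupRing θ := SkewMonoidAlgebra.single x a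

theorem mk_mul_mk (a b : A) (x y : Γ) : mk θ a x * mk θ b y = mk θ (a * θ x b) (x * y) :=
  letI : MulSemiringAction Γ A := MulSemiringAction.compHom A θ
  SkewMonoidAlgebra.single_mul_single

theorem mk_one_one : mk θ 1 1 = 1 := rfl

theorem mk_add (a b : A) (x : Γ) : mk θ (a + b) x = mk θ a x + mk θ b x :=
  SkewMonoidAlgebra.single_add x a b

theorem induction {p : TwistedGroupRing θ → Prop} (z : TwistedGroupRing θ) (h0 : p 0)
    (h1 : ∀ a x, p (mk θ a x)) (h2 : ∀ y z, p y → p z → p (y + z)) : p z :=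
  SkewMonoidAlgebra.induction_on z h0 (fun x a => h1 a x) h2

end TwistedGroupRing

section Extension

/-- The crossed module `(K, Γ, j)` of a group extension `1 → K → Γ → Q → 1`, with conjugation as the
action. -/
def extensionCrossedModule {K Γ Q : Type*} [Group K] [Group Γ] [Group Q]
    (e : GroupExtension K Γ Q) : CrossedModule K Γ where
  act := e.conjAct
  bd := e.inl
  bd_act _ _ := e.inl_conjAct_comm
  peiffer b c := e.inl_injective <| by
    rw [e.inl_conjAct_comm]
    simp

variable {S Q A : Type*} [CommRing S] [Group Q] [MulSemiringAction Q S] [Ring A]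
  [Algebra S A] [Algebra.IsCentral S A] [FaithfulSMul S A]

/-- A group extension `e : 1 → U(A) → Γ → Q → 1` together with a morphism
`(1, ϑ) : (U(A), Γ, j) → (U(A), Aut(A), ∂)` of crossed modules that induces `σ`. -/
structure QNormalStructure.Extension (σ : QNormalStructure S Q A) (Γ : Type*) [Group Γ] where
  e : GroupExtension Aˣ Γ Q
  hom : (extensionCrossedModule e).Hom (autCrossedModule A)
  hom_φ : hom.φ = MonoidHom.id Aˣ
  induces : ∀ x : Γ, (QuotientGroup.mk (hom.ψ x) : Out A) = σ.toHom (e.rightHom x)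

namespace QNormalStructure.Extension

variable {σ : QNormalStructure S Q A} {Γ : Type*} [Group Γ] (X : σ.Extension Γ)

/-- The action `ϑ` of `Γ` on `A`. -/
abbrev ϑ : Γ →* RingAut A := X.hom.ψ

/-- The two-sided ideal of `A^t Γ` generated by the elements `y - j y`, where the unit `y` of `A` is
viewed in `A`, and `j y` in `Γ`. -/
def ideal : TwoSidedIdeal (TwistedGroupRing X.ϑ) :=
  TwoSidedIdeal.span
    (Set.range fun y : Aˣ => TwistedGroupRing.mk X.ϑ (y : A) 1 - TwistedGroupRing.mk X.ϑ 1 (X.e.inl y))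

/-- The crossed product algebra `(A, Q, e, ϑ)`. -/
def CrossedProduct : Type _ := X.ideal.ringCon.Quotient

instance : Ring X.CrossedProduct := inferInstanceAs (Ring X.ideal.ringCon.Quotient)

/-- The projection of the twisted group ring onto the crossed product. -/
def proj : TwistedGroupRing X.ϑ →+* X.CrossedProduct := X.ideal.ringCon.mk'

/-- The canonical map `A → (A, Q, e, ϑ)`. -/
def ofCoeff : A →+* X.CrossedProduct where
  toFun a := X.proj (TwistedGroupRing.mk X.ϑ a 1)
  map_one' := by rw [TwistedGroupRing.mk_one_one, map_one]
  map_mul' a b := by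
    rw [← map_mul, TwistedGroupRing.mk_mul_mk]
    simp
  map_zero' := by
    rw [show TwistedGroupRing.mk X.ϑ 0 1 = 0 from SkewMonoidAlgebra.single_zero _, map_zero]
  map_add' a b := by rw [TwistedGroupRing.mk_add, map_add]

/-- The canonical map from `Γ` to the group of units of `(A, Q, e, ϑ)`. -/
def ofGroup : Γ →* X.CrossedProductˣ :=
  MonoidHom.toHomUnits
    { toFun := fun x => X.proj (TwistedGroupRing.mk X.ϑ 1 x)
      map_one' := by rw [TwistedGroupRing.mk_one_one, map_one]
      map_mul' := fun x y => by
        rw [← map_mul, TwistedGroupRing.mk_mul_mk]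
        simp }

theorem ϑ_algebraMap (y : Γ) (s : S) :
    X.ϑ y (algebraMap S A s) = algebraMap S A (X.e.rightHom y • s) :=
  algebraMap_smul (X.induces y) s

/-- The algebra structure of the crossed product over the fixed ring `R = S^Q`, given by
`R ⊆ S ⊆ A`. -/
instance : Algebra (FixedPoints.subring S Q) X.CrossedProduct :=
  RingHom.toAlgebra' (X.ofCoeff.comp (algebraMap (FixedPoints.subring S Q) A)) fun r z => by
    obtain ⟨z, rfl⟩ := RingCon.mk'_surjective (c := X.ideal.ringCon) z
    change X.proj (TwistedGroupRing.mk X.ϑ (algebraMap S A r) 1) * X.proj z =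
      X.proj z * X.proj (TwistedGroupRing.mk X.ϑ (algebraMap S A r) 1)
    rw [← map_mul, ← map_mul]
    congr 1
    induction z using TwistedGroupRing.induction with
    | h0 => simp
    | h1 a y =>
      have hr : X.e.rightHom y • (r : S) = r := r.2 _
      rw [TwistedGroupRing.mk_mul_mk, TwistedGroupRing.mk_mul_mk, ϑ_algebraMap, hr,
        Algebra.commutes]
      simp
    | h2 y z hy hz => rw [mul_add, add_mul, hy, hz]

end QNormalStructure.Extension

end Extension

end Teichmuller

end

/-!
Write the Teichmüller cocycle of `(A, σ)` in terms of a section `s` of the Teichmüller complex and of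
units `f p q` of `A` that measure the deviation of `s` from a homomorphism. For a fixed section, `f`
is determined up to factors in `U(S)`, and such factors change the cocycle by their coboundary.
Hence the class vanishes if and only if, for one or equivalently for every section, `f` can be chosen
to be a factor set, i.e. such that the 3-cocycle is trivial
(`CrossedTwoFoldExtension.CocycleData.π_eq_zero_iff`).

If the class vanishes, a factor set gives a group structure on `U(A) × Q`, an extension `Γ` of `Q` by
`U(A)`, and `(a, q) ↦ ∂ a * s q` is a homomorphism from `Γ` to the fiber product of `Aut(A)` and `Q`
(`CocycleData.FactorGroup.groupExtension`, `CocycleData.FactorGroup.toΓ`), so that `Γ` acts on `A`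
and induces `σ`.

For any such `Γ`, the coefficients of an element of the twisted group ring at the elements of
`j(U(A))` can be collected into one element of `A`, by `a * j y ↦ a y`. This additive map kills the
ideal that defines the crossed product (`QNormalStructure.Extension.coeffOne_eq_zero`), which makes
`A` embed into the crossed product. There, an element `x` of `Γ` acts on `A` by conjugation through
`ϑ x`, and this yields the strong Deuring embedding that induces `σ`.

Conversely, given a strong Deuring embedding into `C`, every section `s` of the Teichmüller complex
lifts to units `n q` of `C` that normalize `A`, represent `χ q` and induce the automorphism that
underlies `s q`. The units `n p * n q * (n (p * q))⁻¹` of `A` then form a factor set, by associativity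
in `C` (`StrongDeuringEmbedding.teichmullerClass_eq_zero`).
-/

/-! ### Vanishing of the class of a crossed 2-fold extension -/

namespace Teichmuller

open CategoryTheory in
theorem groupCohomology_π_eq_zero_iff {k G : Type u} [CommRing k] [Group G] {B : Rep.{u} k G}
    {n : ℕ} (f : (Fin (n + 1) → G) → B) (h : inhomogeneousCochains.d B (n + 1) f = 0) :
    groupCohomology.π B (n + 1) (groupCohomology.cocyclesMk f h) = 0 ↔
      ∃ y : (Fin n → G) → B, inhomogeneousCochains.d B n y = f := by
  let K := groupCohomology.inhomogeneousCochains B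
  have hex := ShortComplex.exact_of_g_is_cokernel
    (ShortComplex.mk _ _ (K.toCycles_comp_homologyπ n (n + 1)))
    (K.homologyIsCokernel n (n + 1) (by simp))
  have hinj := (ModuleCat.mono_iff_injective (K.iCycles (n + 1))).1 inferInstance
  have hd : ∀ y, K.iCycles (n + 1) (K.toCycles n (n + 1) y) = inhomogeneousCochains.d B n y :=
    fun y => by
      rw [← ConcreteCategory.comp_apply, K.toCycles_i,
        groupCohomology.inhomogeneousCochains.d_def]
  have hf := groupCohomology.iCocycles_mk f h
  constructor
  · intro h0
    obtain ⟨y, hy⟩ := (ShortComplex.moduleCat_exact_iff _).1 hex _ h0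
    exact ⟨y, ((hd y).symm.trans (congrArg _ hy)).trans hf⟩
  · rintro ⟨y, hy⟩
    have : K.toCycles n (n + 1) y = groupCohomology.cocyclesMk f h :=
      hinj (((hd y).trans hy).trans hf.symm)
    rw [← this]
    exact ShortComplex.moduleCat_zero_apply
      (ShortComplex.mk _ _ (K.toCycles_comp_homologyπ n (n + 1))) y

theorem d_moduleRep_two {M G : Type u} [CommGroup M] [Group G] (ρ : G →* MulAut M)
    (m : G → G → M) :
    inhomogeneousCochains.d (moduleRep ρ) 2
        (fun g => (Additive.ofMul (m (g 0) (g 1)) : Additive M)) =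
      fun g => (Additive.ofMul (ρ (g 0) (m (g 1) (g 2)) * (m (g 0 * g 1) (g 2))⁻¹ *
        m (g 0) (g 1 * g 2) * (m (g 0) (g 1))⁻¹) : Additive M) := by
  funext g
  change (Additive.ofMul (ρ (g 0) (m (g 1) (g 2))) : Additive M) +
    Finset.univ.sum (fun j : Fin 3 => ((-1 : ULift.{u} ℤ) ^ ((j : ℕ) + 1)) •
      (Additive.ofMul (m (Fin.contractNth j (· * ·) g 0) (Fin.contractNth j (· * ·) g 1)) :
        Additive M)) = _
  rw [Fin.sum_univ_three]
  change (Additive.ofMul (ρ (g 0) (m (g 1) (g 2))) : Additive M) +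
    (((-1 : ULift.{u} ℤ) ^ 1) • Additive.ofMul (m (g 0 * g 1) (g 2)) +
      ((-1 : ULift.{u} ℤ) ^ 2) • Additive.ofMul (m (g 0) (g 1 * g 2)) +
      ((-1 : ULift.{u} ℤ) ^ 3) • Additive.ofMul (m (g 0) (g 1))) = _
  have e1 : ∀ a : Additive M, (-1 : ULift.{u} ℤ) • a = -a := fun a => by
    rw [neg_smul, one_smul]
  rw [show (-1 : ULift.{u} ℤ) ^ 1 = -1 by ring, show (-1 : ULift.{u} ℤ) ^ 2 = 1 by ring,
    show (-1 : ULift.{u} ℤ) ^ 3 = -1 by ring, one_smul, e1, e1]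
  simp only [ofMul_mul, ofMul_inv]
  abel

namespace CrossedTwoFoldExtension

variable {M G : Type u} [CommGroup M] [Group G] {ρ : G →* MulAut M} {C Γ : Type*}
  [Group C] [Group Γ] {e : CrossedTwoFoldExtension ρ C Γ}

theorem ι_mul_mul_ι_mul (e : CrossedTwoFoldExtension ρ C Γ) (a b : M) (c c' : C) :
    e.ι a * c * (e.ι b * c') = e.ι (a * b) * (c * c') := by
  rw [mul_assoc, ← mul_assoc c, ← e.ι_comm b c, map_mul, mul_assoc, mul_assoc]

/-- If the deviations of the section from a homomorphism are rescaled by central elements, the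
3-cocycle changes by the coboundary of the scaling factors. -/
theorem CocycleData.k_eq_of_f_eq (d d' : e.CocycleData) (hs : d'.s = d.s) (m : G → G → M)
    (hf : ∀ p q, d.f p q = e.ι (m p q) * d'.f p q) (p q r : G) :
    d.k p q r = ρ p (m q r) * (m (p * q) r)⁻¹ * m p (q * r) * (m p q)⁻¹ * d'.k p q r := by
  have h := d.ι_k p q r
  have h' := d'.ι_k p q r
  rw [hs] at h'
  simp only [hf, map_mul (e.act _), e.act_ι, d.π_s, e.ι_mul_mul_ι_mul] at h
  rw [← h', ← mul_assoc (e.ι _) (e.ι _), ← map_mul, ← mul_assoc (e.ι _) (e.ι _), ← map_mul] at h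
  have h2 := e.ι_injective (mul_right_cancel h)
  rw [← eq_mul_inv_iff_mul_eq] at h2
  rw [h2, mul_inv]
  simp only [mul_comm, mul_left_comm, mul_assoc]

/-- The class of a cocycle vanishes if and only if, for the given section, the deviations from a
homomorphism can be chosen to satisfy the identity of a (nonabelian) factor set. -/
theorem CocycleData.π_eq_zero_iff (d : e.CocycleData) :
    groupCohomology.π (moduleRep ρ) 3 (groupCohomology.cocyclesMk d.cochain d.d_cochain) = 0 ↔
      ∃ d' : e.CocycleData, d'.s = d.s ∧ ∀ p q r, d'.k p q r = 1 := by
  rw [groupCohomology_π_eq_zero_iff]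
  constructor
  · rintro ⟨y, hy⟩
    let m : G → G → M := fun p q => Additive.toMul (α := M) (y ![p, q])
    have hm : y = fun g => (Additive.ofMul (m (g 0) (g 1)) : Additive M) := by
      funext g
      exact congrArg y (funext fun i => by fin_cases i <;> rfl)
    rw [hm] at hy
    have hk : ∀ p q r, d.k p q r =
        ρ p (m q r) * (m (p * q) r)⁻¹ * m p (q * r) * (m p q)⁻¹ := fun p q r =>
      (congrFun ((d_moduleRep_two ρ m).symm.trans hy) ![p, q, r]).symm
    -- dividing the deviations by the cochain that bounds the cocycle trivializes the cocycle
    let d' : e.CocycleData :=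
      { s := d.s
        π_s := d.π_s
        f := fun p q => e.ι (m p q)⁻¹ * d.f p q
        bd_f := fun p q => by rw [map_mul, e.bd_ι, one_mul, d.bd_f]
        k := 1
        ι_k := fun p q r => by
          calc
            _ = e.ι ((m p q)⁻¹ * (m (p * q) r)⁻¹) * (d.f p q * d.f (p * q) r) := by
              simp only [Pi.one_apply, map_one, one_mul, e.ι_mul_mul_ι_mul]
            _ = e.ι ((ρ p (m q r))⁻¹ * (m p (q * r))⁻¹ * d.k p q r) *
                (d.f p q * d.f (p * q) r) := by
              rw [hk]
              congr 2
              apply Additive.ofMul.injective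
              simp only [ofMul_mul, ofMul_inv]
              abel
            _ = _ := by
              rw [map_mul, mul_assoc, d.ι_k, map_mul (e.act _), e.act_ι, d.π_s, map_inv (ρ p),
                e.ι_mul_mul_ι_mul] }
    exact ⟨d', rfl, fun _ _ _ => rfl⟩
  · rintro ⟨d', hs, hk⟩
    have hm : ∀ p q, ∃ a, e.ι a = d.f p q * (d'.f p q)⁻¹ := fun p q => by
      have h1 := d.bd_f p q
      have h2 := d'.bd_f p q
      rw [hs, ← h1] at h2
      have : d.f p q * (d'.f p q)⁻¹ ∈ e.ι.range := by
        rw [e.range_ι, MonoidHom.mem_ker, map_mul, map_inv, mul_right_cancel h2, mul_inv_cancel]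
      exact this
    choose m hm using hm
    refine ⟨fun g => (Additive.ofMul (m (g 0) (g 1)) : Additive M), ?_⟩
    rw [d_moduleRep_two]
    funext g
    have := d.k_eq_of_f_eq d' hs m (fun p q => by rw [hm, inv_mul_cancel_right])
      (g 0) (g 1) (g 2)
    rw [hk, mul_one] at this
    exact congrArg Additive.ofMul this.symm

/-- A crossed 2-fold extension with vanishing class admits a factor set: a choice of section with
trivial 3-cocycle. -/
theorem exists_k_eq_one (h : e.cohomologyClass = 0) :
    ∃ d : e.CocycleData, ∀ p q r, d.k p q r = 1 := by
  obtain ⟨d, -, hd⟩ := (CocycleData.π_eq_zero_iff _).1 h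
  exact ⟨d, hd⟩

/-- If every section of `Γ → G` extends to a factor set, then the class vanishes. -/
theorem cohomologyClass_eq_zero
    (h : ∀ s : G → Γ, (∀ q, e.π (s q) = q) →
      ∃ d : e.CocycleData, d.s = s ∧ ∀ p q r, d.k p q r = 1) :
    e.cohomologyClass = 0 :=
  (CocycleData.π_eq_zero_iff _).2 (h _ (CocycleData.π_s _))

end CrossedTwoFoldExtension

/-! ### The group extension of a factor set -/

namespace CrossedTwoFoldExtension

variable {M G : Type*} [CommGroup M] [Group G] {ρ : G →* MulAut M} {C Γ : Type*}
  [Group C] [Group Γ] {e : CrossedTwoFoldExtension ρ C Γ}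

namespace CocycleData

/-- The set that underlies the extension of `G` by `C` with (not necessarily normalized) factor set
`d.f`; the pair `(c, q)` stands for the product of `c` with a lift of `q`. -/
@[ext]
structure FactorGroup (d : e.CocycleData) (_hd : ∀ p q r, d.k p q r = 1) where
  left : C
  right : G

variable {d : e.CocycleData}

theorem act_f_mul_f (hd : ∀ p q r, d.k p q r = 1) (p q r : G) :
    e.act (d.s p) (d.f q r) * d.f p (q * r) = d.f p q * d.f (p * q) r := by
  rw [← d.ι_k, hd, map_one, one_mul]

theorem act_s_one (c : C) : e.act (d.s 1) c = d.f 1 1 * c * (d.f 1 1)⁻¹ := by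
  have h := d.bd_f 1 1
  rw [mul_one, mul_left_inj] at h
  rw [← h, e.peiffer]

theorem act_s_act_s (p q : G) (c : C) :
    e.act (d.s p) (e.act (d.s q) c) = d.f p q * e.act (d.s (p * q)) c * (d.f p q)⁻¹ := by
  rw [← MulAut.mul_apply, ← map_mul, ← d.bd_f, map_mul, MulAut.mul_apply, e.peiffer]

/-- The factor set identity at `(1, 1, r)` shows that `d.f 1 r` does not depend on `r`; together
with `f_one_right` it makes up for the missing normalization. -/
theorem f_one_left (hd : ∀ p q r, d.k p q r = 1) (r : G) : d.f 1 r = d.f 1 1 := by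
  have h := act_f_mul_f hd 1 1 r
  rw [one_mul, one_mul, mul_left_inj, act_s_one, mul_inv_eq_iff_eq_mul, mul_right_inj] at h
  exact h

theorem f_one_right (hd : ∀ p q r, d.k p q r = 1) (p : G) :
    d.f p 1 = e.act (d.s p) (d.f 1 1) := by
  have h := act_f_mul_f hd p 1 1
  rw [mul_one, mul_one, mul_left_inj] at h
  exact h.symm

namespace FactorGroup

variable {hd : ∀ p q r, d.k p q r = 1}

instance : Mul (d.FactorGroup hd) :=
  ⟨fun x y => ⟨x.left * e.act (d.s x.right) y.left * d.f x.right y.right, x.right * y.right⟩⟩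

-- `d.s 1` need not be `1`: its lift is the unit times `d.f 1 1`.
instance : One (d.FactorGroup hd) := ⟨⟨(d.f 1 1)⁻¹, 1⟩⟩

instance : Inv (d.FactorGroup hd) :=
  ⟨fun x => ⟨(d.f 1 1)⁻¹ * (d.f x.right⁻¹ x.right)⁻¹ * (e.act (d.s x.right⁻¹) x.left)⁻¹,
    x.right⁻¹⟩⟩

@[simp] theorem mul_left (x y : d.FactorGroup hd) :
    (x * y).left = x.left * e.act (d.s x.right) y.left * d.f x.right y.right := rfl

@[simp] theorem mul_right (x y : d.FactorGroup hd) : (x * y).right = x.right * y.right := rfl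

@[simp] theorem one_left : (1 : d.FactorGroup hd).left = (d.f 1 1)⁻¹ := rfl

@[simp] theorem one_right : (1 : d.FactorGroup hd).right = 1 := rfl

@[simp] theorem inv_left (x : d.FactorGroup hd) : x⁻¹.left =
    (d.f 1 1)⁻¹ * (d.f x.right⁻¹ x.right)⁻¹ * (e.act (d.s x.right⁻¹) x.left)⁻¹ := rfl

@[simp] theorem inv_right (x : d.FactorGroup hd) : x⁻¹.right = x.right⁻¹ := rfl

instance : Group (d.FactorGroup hd) :=
  Group.ofLeftAxioms
    (fun x y z => by
      ext
      · simp only [mul_left, mul_right, map_mul, mul_assoc, act_f_mul_f hd, act_s_act_s,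
          inv_mul_cancel_left]
      · exact mul_assoc _ _ _)
    (fun x => by
      ext
      · simp only [mul_left, one_left, one_right, act_s_one, f_one_left hd x.right]
        group
      · exact one_mul _)
    (fun x => by
      ext
      · simp only [mul_left, inv_left, inv_right, one_left]
        group
      · exact inv_mul_cancel _)

/-- The lift of the section `d.s` to a homomorphism on the extension. -/
def toΓ : d.FactorGroup hd →* Γ :=
  MonoidHom.mk' (fun x => e.bd x.left * d.s x.right) fun x y => by
    simp only [mul_left, mul_right, map_mul, e.bd_act, mul_assoc, d.bd_f]
    group

theorem toΓ_apply (x : d.FactorGroup hd) : toΓ x = e.bd x.left * d.s x.right := rfl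

/-- The inclusion of `C`; it is corrected by `d.f 1 1`, since `d.f` need not be normalized. -/
def inl : C →* d.FactorGroup hd :=
  MonoidHom.mk' (fun c => ⟨c * (d.f 1 1)⁻¹, 1⟩) fun c c' => by
    ext
    · simp only [mul_left, act_s_one]
      group
    · exact (one_mul 1).symm

@[simp] theorem inl_left (c : C) : (inl c : d.FactorGroup hd).left = c * (d.f 1 1)⁻¹ := rfl

@[simp] theorem inl_right (c : C) : (inl c : d.FactorGroup hd).right = 1 := rfl

theorem toΓ_inl (c : C) : toΓ (inl c : d.FactorGroup hd) = e.bd c := by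
  have h := d.bd_f 1 1
  rw [mul_one, mul_left_inj] at h
  simp only [toΓ_apply, inl, MonoidHom.mk'_apply, map_mul, map_inv, h, inv_mul_cancel_right]

theorem inl_act_mul (x : d.FactorGroup hd) (c : C) :
    inl (e.act (toΓ x) c) * x = x * inl c := by
  rw [toΓ_apply, map_mul, MulAut.mul_apply, e.peiffer]
  ext
  · simp only [mul_left, inl_left, inl_right, act_s_one, f_one_left hd x.right,
      f_one_right hd x.right]
    simp only [map_mul, map_inv]
    group
  · exact (one_mul _).trans (mul_one _).symm

variable (d hd) in
/-- The extension of `G` by `C` with factor set `d.f`. -/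
def groupExtension : GroupExtension C (d.FactorGroup hd) G where
  inl := inl
  rightHom := MonoidHom.mk' right mul_right
  inl_injective c c' h := mul_right_cancel (congrArg left h)
  range_inl_eq_ker_rightHom := by
    ext x
    constructor
    · rintro ⟨c, rfl⟩
      rfl
    · intro hx
      refine ⟨x.left * d.f 1 1, ?_⟩
      ext
      · exact mul_inv_cancel_right _ _
      · exact Eq.symm hx
  rightHom_surjective q := ⟨⟨1, q⟩, rfl⟩

theorem conjAct_groupExtension (x : d.FactorGroup hd) (c : C) :
    (groupExtension d hd).conjAct x c = e.act (toΓ x) c := by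
  apply (groupExtension d hd).inl_injective
  rw [GroupExtension.inl_conjAct_comm, mul_inv_eq_iff_eq_mul]
  exact (inl_act_mul x c).symm

end FactorGroup

end CocycleData

end CrossedTwoFoldExtension

end Teichmuller

noncomputable section

namespace Teichmuller

/-! ### Strong Deuring embeddings and the Teichmüller class -/

section Deuring

variable {S Q : Type u} {A : Type v} [CommRing S] [Group Q] [MulSemiringAction Q S] [Ring A]
  [Algebra S A] [Algebra.IsCentral S A] [FaithfulSMul S A]

/-- If the Teichmüller class vanishes, then the extension with a factor set of the Teichmüller
complex acts on `A` and induces the normal structure. -/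
theorem QNormalStructure.exists_extension (σ : QNormalStructure S Q A)
    (h : σ.teichmullerClass = 0) :
    ∃ (Γ : Type (max u v)) (_ : Group Γ), Nonempty (σ.Extension Γ) := by
  obtain ⟨d, hd⟩ := CrossedTwoFoldExtension.exists_k_eq_one h
  exact ⟨d.FactorGroup hd, inferInstance, ⟨
    { e := CrossedTwoFoldExtension.CocycleData.FactorGroup.groupExtension d hd
      hom :=
        { φ := MonoidHom.id Aˣ
          ψ := ((MonoidHom.fst _ _).comp σ.fiberProduct.subtype).comp
            CrossedTwoFoldExtension.CocycleData.FactorGroup.toΓ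
          bd_φ := fun c => congrArg (fun y => y.1.1)
            (CrossedTwoFoldExtension.CocycleData.FactorGroup.toΓ_inl (hd := hd) c).symm
          equivariant := fun x c =>
            CrossedTwoFoldExtension.CocycleData.FactorGroup.conjAct_groupExtension x c }
      hom_φ := rfl
      induces := fun x => by
        refine Eq.trans (CrossedTwoFoldExtension.CocycleData.FactorGroup.toΓ x).2 ?_
        have h2 : (d.s x.right).1.2 = x.right := d.π_s x.right
        exact congrArg σ.toHom ((one_mul _).trans h2) }⟩⟩

variable {C : Type*} [Ring C] [Algebra (FixedPoints.subring S Q) C]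

/-- Every automorphism in the outer class that `D` assigns to `q` is conjugation by a representative of `χ q`. -/
theorem StrongDeuringEmbedding.exists_conjHom_eq (D : StrongDeuringEmbedding S Q A C) (q : Q)
    (α : RingAut A) (h : (QuotientGroup.mk α : Out A) = D.normalStructure.toHom q) :
    ∃ n : unitNormalizer (D.emb : A →+* C),
      normalizerMk D.injective n = D.χ q ∧ conjHom D.injective n = α := by
  have := normal_unitsIncl_range D.injective
  obtain ⟨n, hn⟩ := QuotientGroup.mk_surjective (s := (unitsIncl (D.emb : A →+* C)).range) (D.χ q)
  have hn' : normalizerMk D.injective n = D.χ q := hn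
  have h1 : (QuotientGroup.mk (conjHom D.injective n) : Out A) = QuotientGroup.mk α := by
    rw [h]
    exact congrArg (conjOut D.injective) hn'
  obtain ⟨a, ha⟩ := QuotientGroup.eq.1 h1
  refine ⟨n * unitsIncl _ a, ?_, ?_⟩
  · have : normalizerMk D.injective (unitsIncl _ a) = 1 :=
      (QuotientGroup.eq_one_iff _).2 ⟨a, rfl⟩
    rw [map_mul, this, mul_one, hn']
  · rw [map_mul, conjHom_unitsIncl, ha, mul_inv_cancel_left]

/-- The Teichmüller class of the normal structure of a strong Deuring embedding vanishes: units of
`C` that lift a section of the Teichmüller complex measure its deviation from a homomorphism by a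
factor set, thanks to associativity in `C`. -/
theorem StrongDeuringEmbedding.teichmullerClass_eq_zero (D : StrongDeuringEmbedding S Q A C) :
    D.normalStructure.teichmullerClass = 0 := by
  refine CrossedTwoFoldExtension.cohomologyClass_eq_zero fun s hs => ?_
  have hs' : ∀ q, (QuotientGroup.mk (s q).1.1 : Out A) = D.normalStructure.toHom q := fun q =>
    (s q).2.trans (congrArg D.normalStructure.toHom (hs q))
  choose n hχ hn using fun q => D.exists_conjHom_eq q _ (hs' q)
  have hf : ∀ p q, ∃ a : Aˣ, unitsIncl _ a * n (p * q) = n p * n q := fun p q => by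
    have h1 : normalizerMk D.injective (n p * n q * (n (p * q))⁻¹) = 1 := by
      rw [map_mul, map_mul, map_inv, hχ, hχ, hχ, map_mul, mul_inv_cancel]
    have := normal_unitsIncl_range D.injective
    obtain ⟨a, ha⟩ := (QuotientGroup.eq_one_iff _).1 h1
    exact ⟨a, by rw [ha, inv_mul_cancel_right]⟩
  choose f hf using hf
  have hinj : Function.Injective (unitsIncl (D.emb : A →+* C)) := fun a b h =>
    Units.ext (D.injective (congrArg
      (fun y : unitNormalizer (D.emb : A →+* C) => ((y : Cˣ) : C)) h))
  have hact : ∀ q a, unitsIncl (D.emb : A →+* C) (unitsAut A (s q).1.1 a) * n q =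
      n q * unitsIncl _ a := fun q a => by
    rw [← eq_mul_inv_iff_mul_eq, ← hn]
    ext
    exact map_conjAut D.injective (n q) (a : A)
  refine ⟨⟨s, hs, f, fun p q => ?_, fun _ _ _ => 1, fun p q r => ?_⟩, rfl, fun _ _ _ => rfl⟩
  · have h1 := congrArg (conjHom D.injective) (hf p q)
    rw [map_mul, map_mul, conjHom_unitsIncl, hn, hn, hn] at h1
    refine Subtype.ext (Prod.ext h1 ?_)
    have h2 : ∀ q, (s q).1.2 = q := hs
    change 1 * (s (p * q)).1.2 = (s p).1.2 * (s q).1.2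
    rw [h2, h2, h2, one_mul]
  · rw [map_one, one_mul]
    apply hinj
    change _ = unitsIncl (D.emb : A →+* C) (unitsAut A (s p).1.1 (f q r) * f p (q * r))
    apply mul_right_cancel (b := n (p * q * r))
    calc
      _ = n p * n q * n r := by rw [map_mul, mul_assoc, hf, ← mul_assoc, hf]
      _ = n p * (unitsIncl _ (f q r) * n (q * r)) := by rw [hf, mul_assoc]
      _ = _ := by rw [map_mul, mul_assoc p, mul_assoc (unitsIncl _ _), hf p (q * r), ← mul_assoc,
        ← mul_assoc, hact]

end Deuring

/-! ### The crossed product as a strong Deuring embedding -/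

/-- A group extension, with the group in the middle lifted to a larger universe. -/
def uliftGroupExtension {N E G : Type*} [Group N] [Group E] [Group G] (e : GroupExtension N E G) :
    GroupExtension N (ULift.{w} E) G where
  inl := MulEquiv.ulift.symm.toMonoidHom.comp e.inl
  rightHom := e.rightHom.comp MulEquiv.ulift.toMonoidHom
  inl_injective := MulEquiv.ulift.symm.injective.comp e.inl_injective
  range_inl_eq_ker_rightHom := by
    ext ⟨x⟩
    refine Iff.trans ⟨?_, ?_⟩ (SetLike.ext_iff.1 e.range_inl_eq_ker_rightHom x)
    · rintro ⟨y, hy⟩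
      exact ⟨y, congrArg ULift.down hy⟩
    · rintro ⟨y, hy⟩
      exact ⟨y, congrArg ULift.up hy⟩
  rightHom_surjective q := by
    obtain ⟨x, hx⟩ := e.rightHom_surjective q
    exact ⟨⟨x⟩, hx⟩

namespace QNormalStructure.Extension

section

variable {S Q A : Type*} [CommRing S] [Group Q] [MulSemiringAction Q S] [Ring A]
  [Algebra S A] [Algebra.IsCentral S A] [FaithfulSMul S A] {σ : QNormalStructure S Q A}
  {Γ : Type*} [Group Γ] (X : σ.Extension Γ)

theorem ϑ_inl (y : Aˣ) : X.ϑ (X.e.inl y) = innerAut A y := by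
  have h := X.hom.bd_φ y
  rw [X.hom_φ] at h
  exact h.symm

theorem inl_ϑ (x : Γ) (y : Aˣ) :
    X.e.inl (unitsAut A (X.ϑ x) y) = x * X.e.inl y * x⁻¹ := by
  have h := X.hom.equivariant x y
  rw [X.hom_φ] at h
  exact (congrArg X.e.inl h.symm).trans X.e.inl_conjAct_comm

open Classical in
/-- The element of `A` that represents `x : Γ` in the crossed product if `x` comes from a unit of
`A`, and zero otherwise. -/
def unitPart (x : Γ) : A := if h : ∃ y, X.e.inl y = x then (h.choose : A) else 0

theorem unitPart_inl (y : Aˣ) : X.unitPart (X.e.inl y) = y := by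
  have h : ∃ y', X.e.inl y' = X.e.inl y := ⟨y, rfl⟩
  rw [unitPart, dif_pos h, X.e.inl_injective h.choose_spec]

theorem unitPart_inl_mul (y : Aˣ) (x : Γ) :
    X.unitPart (X.e.inl y * x) = y * X.unitPart x := by
  by_cases h : ∃ z, X.e.inl z = x
  · obtain ⟨z, rfl⟩ := h
    rw [← map_mul, unitPart_inl, unitPart_inl, Units.val_mul]
  · have h' : ¬ ∃ z, X.e.inl z = X.e.inl y * x := fun ⟨z, hz⟩ =>
      h ⟨y⁻¹ * z, by rw [map_mul, hz, map_inv, inv_mul_cancel_left]⟩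
    rw [unitPart, dif_neg h', unitPart, dif_neg h, mul_zero]

/-- The projection of the twisted group ring onto the component of the crossed product at
`1 : Q`, which is `A`. -/
def coeffOne : TwistedGroupRing X.ϑ →+ A :=
  (Finsupp.liftAddHom fun x : Γ => AddMonoidHom.mulRight (X.unitPart x)).comp
    (SkewMonoidAlgebra.coeffAddEquiv (k := A) (G := Γ)).toAddMonoidHom

theorem coeffOne_mk (a : A) (x : Γ) :
    X.coeffOne (TwistedGroupRing.mk X.ϑ a x) = a * X.unitPart x :=
  Finsupp.liftAddHom_apply_single _ _ _

theorem coeffOne_mul_mul_eq_zero (y : Aˣ) (z z' : TwistedGroupRing X.ϑ) :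
    X.coeffOne (z * (TwistedGroupRing.mk X.ϑ (y : A) 1 -
      TwistedGroupRing.mk X.ϑ 1 (X.e.inl y)) * z') = 0 := by
  induction z using TwistedGroupRing.induction with
  | h0 => simp
  | h2 z₁ z₂ h₁ h₂ => rw [add_mul, add_mul, map_add, h₁, h₂, add_zero]
  | h1 a x =>
    induction z' using TwistedGroupRing.induction with
    | h0 => simp
    | h2 z₁ z₂ h₁ h₂ => rw [mul_add, map_add, h₁, h₂, add_zero]
    | h1 b x' =>
      have hx : x * X.e.inl y * x' = X.e.inl (unitsAut A (X.ϑ x) y) * (x * x') := by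
        rw [inl_ϑ]
        group
      simp only [mul_sub, sub_mul, TwistedGroupRing.mk_mul_mk, map_sub, coeffOne_mk]
      rw [hx, unitPart_inl_mul, map_mul X.ϑ x (X.e.inl y), ϑ_inl, RingAut.mul_apply, innerAut_apply,
        coe_unitsAut, map_one, mul_one, mul_one, sub_eq_zero]
      -- the inverse of `y` that conjugation leaves on the right of `b` cancels
      have hy : X.ϑ x ((y⁻¹ : Aˣ) : A) * X.ϑ x y = 1 := by
        rw [← map_mul, Units.inv_mul, map_one]
      simp only [map_mul, mul_assoc]
      rw [← mul_assoc (X.ϑ x ((y⁻¹ : Aˣ) : A)), hy, one_mul]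

/-- The projection kills the defining ideal of the crossed product and therefore descends to it. -/
theorem coeffOne_eq_zero {z : TwistedGroupRing X.ϑ} (hz : z ∈ X.ideal) : X.coeffOne z = 0 := by
  rw [ideal, TwoSidedIdeal.mem_span_iff_mem_addSubgroup_closure] at hz
  induction hz using AddSubgroup.closure_induction with
  | zero => exact map_zero _
  | add a b _ _ ha hb => rw [map_add, ha, hb, add_zero]
  | neg a _ ha => rw [map_neg, ha, neg_zero]
  | mem a ha =>
    obtain ⟨_, ⟨z, -, _, ⟨y, rfl⟩, rfl⟩, z', -, rfl⟩ := ha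
    exact X.coeffOne_mul_mul_eq_zero y z z'

/-- The component at `1 : Q` recovers `a` from its image in the crossed product. -/
theorem ofCoeff_injective : Function.Injective X.ofCoeff := by
  rw [injective_iff_map_eq_zero]
  intro a ha
  have h1 : TwistedGroupRing.mk X.ϑ a 1 ∈ X.ideal := (RingCon.eq _).1 ha
  have h2 := X.coeffOne_eq_zero h1
  rwa [coeffOne_mk, ← map_one X.e.inl, unitPart_inl, Units.val_one, mul_one] at h2

theorem ofCoeff_unit (y : Aˣ) : X.ofCoeff y = X.ofGroup (X.e.inl y) := by
  refine (RingCon.eq _).2 ((X.ideal.rel_iff _ _).2 ?_)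
  exact TwoSidedIdeal.subset_span ⟨y, rfl⟩

theorem ofGroup_mul_ofCoeff (x : Γ) (a : A) :
    (X.ofGroup x : X.CrossedProduct) * X.ofCoeff a = X.ofCoeff (X.ϑ x a) * X.ofGroup x := by
  change X.proj _ * X.proj _ = X.proj _ * X.proj _
  rw [← map_mul, ← map_mul, TwistedGroupRing.mk_mul_mk, TwistedGroupRing.mk_mul_mk]
  simp

theorem ofGroup_conj_ofCoeff (x : Γ) (a : A) :
    (X.ofGroup x : X.CrossedProduct) * X.ofCoeff a * ((X.ofGroup x)⁻¹ : X.CrossedProductˣ) =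
      X.ofCoeff (X.ϑ x a) := by
  rw [ofGroup_mul_ofCoeff, Units.mul_inv_cancel_right]

theorem ofGroup_mem_unitNormalizer (x : Γ) : X.ofGroup x ∈ unitNormalizer X.ofCoeff := by
  intro c
  constructor
  · rintro ⟨a, rfl⟩
    exact ⟨_, (X.ofGroup_conj_ofCoeff x a).symm⟩
  · rintro ⟨a, ha⟩
    refine ⟨_, (X.ofGroup_conj_ofCoeff x⁻¹ a).symm.trans ?_⟩
    rw [ha, map_inv, inv_inv]
    simp [mul_assoc]

/-- The canonical map from `Γ` to the normalizer of `A` in the crossed product. -/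
def toNormalizer : Γ →* unitNormalizer X.ofCoeff :=
  X.ofGroup.codRestrict _ X.ofGroup_mem_unitNormalizer

theorem conjHom_toNormalizer (x : Γ) : conjHom X.ofCoeff_injective (X.toNormalizer x) = X.ϑ x := by
  ext a
  apply X.ofCoeff_injective
  exact (map_conjAut X.ofCoeff_injective _ a).trans (X.ofGroup_conj_ofCoeff x a)

/-- The homomorphism `χ : Q → N^{U(C)}(A)/U(A)` induced by `Γ → N^{U(C)}(A)`. -/
def toNormalizerQuotient : Q →* NormalizerQuotient X.ofCoeff_injective :=
  X.e.rightHom.liftOfSurjective X.e.rightHom_surjective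
    ⟨(normalizerMk X.ofCoeff_injective).comp X.toNormalizer, by
      rw [← X.e.range_inl_eq_ker_rightHom]
      rintro _ ⟨y, rfl⟩
      have := normal_unitsIncl_range X.ofCoeff_injective
      refine (QuotientGroup.eq_one_iff (N := (unitsIncl X.ofCoeff).range) _).2 ⟨y, ?_⟩
      ext
      exact X.ofCoeff_unit y⟩

theorem toNormalizerQuotient_rightHom (x : Γ) :
    X.toNormalizerQuotient (X.e.rightHom x) =
      normalizerMk X.ofCoeff_injective (X.toNormalizer x) :=
  MonoidHom.liftOfRightInverse_comp_apply _ _ _ _ x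

theorem conjOut_comp_toNormalizerQuotient :
    (conjOut X.ofCoeff_injective).comp X.toNormalizerQuotient = σ.toHom := by
  ext q
  obtain ⟨x, rfl⟩ := X.e.rightHom_surjective q
  rw [MonoidHom.comp_apply, toNormalizerQuotient_rightHom, ← X.induces]
  exact congrArg QuotientGroup.mk (X.conjHom_toNormalizer x)

/-- The strong Deuring embedding of `A` into the crossed product. -/
def strongDeuringEmbedding : StrongDeuringEmbedding S Q A X.CrossedProduct where
  emb := { X.ofCoeff with commutes' := fun _ => rfl }
  injective := X.ofCoeff_injective
  χ := X.toNormalizerQuotient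
  lifts := by
    rw [← σ.lifts, ← X.conjOut_comp_toNormalizerQuotient]
    rfl

theorem normalStructure_strongDeuringEmbedding :
    X.strongDeuringEmbedding.normalStructure = σ := by
  obtain ⟨f, hf⟩ := σ
  have h : X.strongDeuringEmbedding.normalStructure.toHom = f :=
    X.conjOut_comp_toNormalizerQuotient
  generalize X.strongDeuringEmbedding.normalStructure = τ at h
  cases τ
  cases h
  rfl

/-- An extension that induces `σ`, lifted to a larger universe. -/
def ulift : σ.Extension (ULift.{w} Γ) where
  e := uliftGroupExtension X.e
  hom :=
    { φ := MonoidHom.id Aˣ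
      ψ := X.ϑ.comp (MulEquiv.ulift (α := Γ)).toMonoidHom
      bd_φ := fun y => (X.ϑ_inl y).symm
      equivariant := fun x y => (uliftGroupExtension X.e).inl_injective <| by
        refine (GroupExtension.inl_conjAct_comm _).trans ?_
        exact congrArg ULift.up (X.inl_ϑ x.down y).symm }
  hom_φ := rfl
  induces := fun x => X.induces x.down

end

end QNormalStructure.Extension

end Teichmuller

end

open Teichmuller in
theorem theorem4p3 {S Q : Type u} {A : Type v} [CommRing S] [Group Q] [MulSemiringAction Q S]
    [Ring A] [Algebra S A] [Algebra.IsCentral S A] [FaithfulSMul S A] :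
    (∀ σ : QNormalStructure S Q A,
      σ.teichmullerClass = 0 ↔
        ∃ (C : Type (max u v w)) (_ : Ring C) (_ : Algebra (FixedPoints.subring S Q) C)
          (D : StrongDeuringEmbedding S Q A C), D.normalStructure = σ) ∧
    ((∃ (C : Type (max u v w)) (_ : Ring C) (_ : Algebra (FixedPoints.subring S Q) C),
        Nonempty (StrongDeuringEmbedding S Q A C)) ↔
      ∃ σ : QNormalStructure S Q A, σ.teichmullerClass = 0) ∧
    (∀ σ : QNormalStructure S Q A, σ.teichmullerClass = 0 →
      ∃ (Γ : Type (max u v)) (_ : Group Γ), Nonempty (σ.Extension Γ)) ∧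
    (∀ (σ : QNormalStructure S Q A) (Γ : Type x) [Group Γ] (X : σ.Extension Γ),
      ∃ D : StrongDeuringEmbedding S Q A X.CrossedProduct,
        (∀ a : A, D.emb a = X.ofCoeff a) ∧
        (∀ y : Γ, ∃ hy : X.ofGroup y ∈ unitNormalizer (D.emb : A →+* X.CrossedProduct),
          D.χ (X.e.rightHom y) = normalizerMk D.injective ⟨X.ofGroup y, hy⟩) ∧
        D.normalStructure = σ) := by
  have key : ∀ σ : QNormalStructure S Q A, σ.teichmullerClass = 0 →
      ∃ (C : Type (max u v w)) (_ : Ring C) (_ : Algebra (FixedPoints.subring S Q) C)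
        (D : StrongDeuringEmbedding S Q A C), D.normalStructure = σ := fun σ h => by
    obtain ⟨Γ, _, ⟨X⟩⟩ := σ.exists_extension h
    -- the crossed product has to live in `Type (max u v w)`, hence the lift of `Γ`
    exact ⟨(QNormalStructure.Extension.ulift.{w} X).CrossedProduct, inferInstance, inferInstance,
      _, QNormalStructure.Extension.normalStructure_strongDeuringEmbedding _⟩
  refine ⟨fun σ => ⟨key σ, ?_⟩, ⟨?_, ?_⟩, fun σ h => σ.exists_extension h, fun σ Γ _ X =>
    ⟨X.strongDeuringEmbedding, fun _ => rfl, fun y =>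
      ⟨X.ofGroup_mem_unitNormalizer y, X.toNormalizerQuotient_rightHom y⟩,
      X.normalStructure_strongDeuringEmbedding⟩⟩
  · rintro ⟨C, _, _, D, rfl⟩
    exact D.teichmullerClass_eq_zero
  · rintro ⟨C, _, _, ⟨D⟩⟩
    exact ⟨_, D.teichmullerClass_eq_zero⟩
  · rintro ⟨σ, h⟩
    obtain ⟨C, _, _, D, -⟩ := key σ h
    exact ⟨C, _, _, ⟨D⟩⟩
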